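/- Let $d\ge 1$, let $X=[0,1]^d$ with the Euclidean distance $\rho$, and suppose that there are no obstacles. Let $s_1,\dots,s_n\in X$ be a deterministic sequence of samples with dispersion $D_n=\sup_{x\in X}\min_j\rho(x,s_j)$. Assume that the sequence has low dispersion, $D_n\le C n^{-1/d}$, and that it is no denser than a uniform sequence: every ball of radius $t\ge n^{-1/d}$ with centre in $X$ contains at most $K n t^d$ of the samples. Let the start $a$ and the target $b$ be any two of the samples. Edge batching with sample pruning works as follows. Let $r_0$ satisfy $2D_n<r_0\le R\,n^{-1/d}$ and put $r_{i+1}=2^{1/d}r_i$. Let $V_0$ be the set of all samples. Batch $i$ searches the graph $G_i$ on $V_i$ in which two vertices are joined by an edge if their distance is at most $r_i$. Let $c_i$ be the length of a shortest path from $a$ to $b$ in $G_i$ ($c_i=\infty$ if there is none). Then all vertices outside the informed set (a prolate hyperspheroid with foci $a$, $b$) are pruned: $V_{i+1}=\{v\in V_i:\rho(a,v)+\rho(v,b)\le c_i\}$. The last batch is the first one with $r_i\ge\sqrt d$. In the worst case, batch $i$ evaluates all edges of $G_i$. Then the number of batches is $O(\log n)$, and the worst-case total number of edge evaluations $\sum_i|E(G_i)|$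 over all batches is $O(n^{1+1/d})$. The implied constants depend only on $d$, $C$, $K$ and $R$. -/

import Mathlib

open scoped ENNReal

noncomputable section

namespace EdgeBatching

/-- The configuration space `[0,1]^d`, inside `d`-dimensional Euclidean space. -/
def unitCube (d : ℕ) : Set (EuclideanSpace ℝ (Fin d)) :=
  {x | ∀ k, x k ∈ Set.Icc (0 : ℝ) 1}

/-- The dispersion `sup_{x ∈ [0,1]^d} min_j ‖x - s_j‖` of the samples `s_1, …, s_n`. -/
def dispersion {d n : ℕ} (s : Fin n → EuclideanSpace ℝ (Fin d)) : ℝ :=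
  ⨆ x : unitCube d, ⨅ j : Fin n, dist (x : EuclideanSpace ℝ (Fin d)) (s j)

/-- The samples have low dispersion, with constant `C`: `D_n ≤ C n^{-1/d}`. -/
def LowDispersion {d n : ℕ} (C : ℝ) (s : Fin n → EuclideanSpace ℝ (Fin d)) : Prop :=
  dispersion s ≤ C * (n : ℝ) ^ (-(1 / (d : ℝ)))

/-- The samples are spread out, with constant `K`: down to the scale `n^{-1/d}` of the sample
spacing, a ball of radius `ρ` contains at most `K n ρ^d` of them, i.e. their number is at most
proportional to the volume of the ball. -/
def SpreadOut {d n : ℕ} (K : ℝ) (s : Fin n → EuclideanSpace ℝ (Fin d)) : Prop :=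
  ∀ x ∈ unitCube d, ∀ ρ : ℝ, (n : ℝ) ^ (-(1 / (d : ℝ))) ≤ ρ →
    (({j : Fin n | dist (s j) x ≤ ρ}.ncard : ℕ) : ℝ) ≤ K * n * ρ ^ d

/-- The `r`-disk graph on the samples with index in `V`. Space is free of obstacles, so every
edge is collision-free. -/
def diskGraph {d n : ℕ} (s : Fin n → EuclideanSpace ℝ (Fin d)) (V : Finset (Fin n)) (r : ℝ) :
    SimpleGraph (Fin n) where
  Adj u v := u ≠ v ∧ u ∈ V ∧ v ∈ V ∧ dist (s u) (s v) ≤ r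
  symm := ⟨fun u v h => ⟨h.1.symm, h.2.2.1, h.2.1, by rw [dist_comm]; exact h.2.2.2⟩⟩
  loopless := ⟨fun _ h => h.1 rfl⟩

/-- The cost of a path in a graph on the samples: the sum of the Euclidean lengths of its edges. -/
def walkCost {d n : ℕ} (s : Fin n → EuclideanSpace ℝ (Fin d)) {G : SimpleGraph (Fin n)}
    {u v : Fin n} (p : G.Walk u v) : ℝ≥0∞ :=
  (p.darts.map fun e => edist (s e.fst) (s e.snd)).sum

/-- The cost of a shortest path from `a` to `b`; it is `∞` if there is none. -/
def shortestCost {d n : ℕ} (s : Fin n → EuclideanSpace ℝ (Fin d)) (G : SimpleGraph (Fin n))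
    (a b : Fin n) : ℝ≥0∞ :=
  ⨅ p : G.Walk a b, walkCost s p

/-- The informed set: the points through which a path from `x` to `y` of length at most `c` may
pass. It is a prolate hyperspheroid with foci `x` and `y` (and everything if `c = ∞`). -/
def informedSet {d : ℕ} (x y : EuclideanSpace ℝ (Fin d)) (c : ℝ≥0∞) :
    Set (EuclideanSpace ℝ (Fin d)) :=
  {z | edist x z + edist z y ≤ c}

/-- The connection radii: `r_{i+1} = 2^{1/d} r_i`. -/
def radius (d : ℕ) (r₀ : ℝ) : ℕ → ℝ
  | 0 => r₀
  | i + 1 => (2 : ℝ) ^ (1 / (d : ℝ)) * radius d r₀ i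

open Classical in
/-- The vertices in use in batch `i`. Batch `0` uses all samples. After batch `i` is searched, the
vertices outside the informed set of the solution which that batch found are pruned. -/
def activeVertices {d n : ℕ} (s : Fin n → EuclideanSpace ℝ (Fin d)) (a b : Fin n) (r₀ : ℝ) :
    ℕ → Finset (Fin n)
  | 0 => Finset.univ
  | i + 1 => (activeVertices s a b r₀ i).filter fun v =>
      s v ∈ informedSet (s a) (s b)
        (shortestCost s (diskGraph s (activeVertices s a b r₀ i) (radius d r₀ i)) a b)

/-- The graph searched in batch `i`: the `r_i`-disk graph on the vertices not yet pruned. -/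
def batchGraph {d n : ℕ} (s : Fin n → EuclideanSpace ℝ (Fin d)) (a b : Fin n) (r₀ : ℝ) (i : ℕ) :
    SimpleGraph (Fin n) :=
  diskGraph s (activeVertices s a b r₀ i) (radius d r₀ i)

/-- The number of batches: the last batch is the first one whose radius is at least `√d`, the
diameter of the cube, so that its graph is complete. -/
def numBatches (d : ℕ) (r₀ : ℝ) : ℕ :=
  sInf {i : ℕ | √(d : ℝ) ≤ radius d r₀ i} + 1

/-- The worst-case number of edge evaluations of the whole search: each batch may have to evaluate
every edge of the graph that it searches. -/
def totalEdgeEvaluations {d n : ℕ} (s : Fin n → EuclideanSpace ℝ (Fin d)) (a b : Fin n)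
    (r₀ : ℝ) : ℕ :=
  ∑ i ∈ Finset.range (numBatches d r₀), (batchGraph s a b r₀ i).edgeSet.ncard

end EdgeBatching

end

/-! Put `q = 2^(1/d)`, so that `r_i = q^i r₀`. The initial radius has order `n^(-1/d)`: the upper
bound is assumed, and `n^(-1/d) ≤ 2 D_n < r₀` because no `n` points cover the cube better
(`rpow_neg_le_two_mul_of_cover`). Hence `q^i` only has to reach order `n^(1/d)`, which takes `O(log
n)` batches.

A vertex of `G_i` has `O(n r_i^d) = O(q^(id))` neighbours, and pruning has to compensate for this
growth. Replacing equally spaced points of the segment from `a` to `b` by nearby samples gives a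
path of relative excess `O((D_n / r_i)^2) = O(q^(-2i))`; it is quadratic since the first-order
errors telescope (`shortestCost_diskGraph_le`). The bound survives earlier pruning
(`shortestCost_batchGraph_le`). The informed set is then a tube of width `O(q^(-i))` around the
segment, covered by `O(q^i)` balls of comparable radius, so `O(q^i n q^(-id))` samples remain
(`card_le_of_near_segment`). Multiplied by the degree, the factor `q^(id)` cancels: each batch has
`O(n q^i)` edges (`ncard_edgeSet_batchGraph_le`), and the geometric sum is governed by its last
term, of order `n^(1+1/d)`. -/

namespace EdgeBatching

/-! ### Geometry of the cube and the lower bound on dispersion -/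

section Cube

variable {d n : ℕ}

lemma dist_le_sqrt_of_mem_unitCube {x y : EuclideanSpace ℝ (Fin d)}
    (hx : x ∈ unitCube d) (hy : y ∈ unitCube d) : dist x y ≤ √(d : ℝ) := by
  rw [EuclideanSpace.dist_eq]
  apply Real.sqrt_le_sqrt
  calc ∑ i, dist (x i) (y i) ^ 2 ≤ ∑ _i : Fin d, (1 : ℝ) := by
        refine Finset.sum_le_sum fun i _ => ?_
        have h1 := hx i
        have h2 := hy i
        have : dist (x i) (y i) ≤ 1 := by
          rw [Real.dist_eq, abs_le]
          constructor <;> linarith [h1.1, h1.2, h2.1, h2.2]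
        exact pow_le_one₀ dist_nonneg this
    _ = d := by simp

lemma convex_unitCube : Convex ℝ (unitCube d) := by
  intro x hx y hy a b ha hb hab k
  have h1 := hx k
  have h2 := hy k
  simp only [PiLp.add_apply, PiLp.smul_apply, smul_eq_mul]
  exact convex_Icc (0 : ℝ) 1 h1 h2 ha hb hab

lemma add_smul_sub_mem_unitCube {x y : EuclideanSpace ℝ (Fin d)}
    (hx : x ∈ unitCube d) (hy : y ∈ unitCube d) {t : ℝ} (h0 : 0 ≤ t) (h1 : t ≤ 1) :
    x + t • (y - x) ∈ unitCube d :=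
  convex_unitCube.add_smul_sub_mem hx hy ⟨h0, h1⟩

lemma exists_dist_le_dispersion [Nonempty (Fin n)] {s : Fin n → EuclideanSpace ℝ (Fin d)}
    (hs : ∀ j, s j ∈ unitCube d) {x : EuclideanSpace ℝ (Fin d)} (hx : x ∈ unitCube d) :
    ∃ j, dist x (s j) ≤ dispersion s := by
  obtain ⟨j, hj⟩ := exists_eq_ciInf_of_finite (f := fun j => dist x (s j))
  refine ⟨j, ?_⟩
  rw [hj]
  refine le_ciSup (f := fun x : unitCube d => ⨅ j, dist (x : EuclideanSpace ℝ (Fin d)) (s j))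
    ⟨√(d : ℝ), ?_⟩ ⟨x, hx⟩
  rintro _ ⟨y, rfl⟩
  exact (ciInf_le (Set.finite_range _).bddBelow j).trans
    (dist_le_sqrt_of_mem_unitCube y.2 (hs j))

/-- By the pigeonhole principle, two points of a grid with more than `n` points have a common
nearest sample. -/
lemma rpow_neg_le_two_mul_of_cover (hd : 1 ≤ d) (hn : 1 ≤ n)
    {s : Fin n → EuclideanSpace ℝ (Fin d)} {D : ℝ}
    (hD : ∀ x ∈ unitCube d, ∃ j, dist x (s j) ≤ D) :
    (n : ℝ) ^ (-(1 / (d : ℝ))) ≤ 2 * D := by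
  have hn1 : (1 : ℝ) ≤ n := by exact_mod_cast hn
  have hd0 : (d : ℝ) ≠ 0 := by positivity
  have hm1 : (1 : ℝ) ≤ (n : ℝ) ^ (1 / (d : ℝ)) := Real.one_le_rpow hn1 (by positivity)
  -- The floor gives a grid of `(m + 1)^d > n` points whose spacing `1/m` is still at least
  -- `n^(-1/d)`.
  set m := ⌊(n : ℝ) ^ (1 / (d : ℝ))⌋₊ with hm
  have hmpos : 1 ≤ m := Nat.le_floor (by simpa using hm1)
  have hmpos' : (0 : ℝ) < m := by exact_mod_cast hmpos
  have hcard : n < (m + 1) ^ d := by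
    have h1 : (n : ℝ) ^ (1 / (d : ℝ)) < m + 1 := Nat.lt_floor_add_one _
    have h2 : ((n : ℝ) ^ (1 / (d : ℝ))) ^ d < ((m : ℝ) + 1) ^ d :=
      pow_lt_pow_left₀ h1 (by positivity) (by omega)
    rw [← Real.rpow_natCast, ← Real.rpow_mul (by positivity), one_div_mul_cancel hd0,
      Real.rpow_one] at h2
    exact_mod_cast h2
  let g : (Fin d → Fin (m + 1)) → EuclideanSpace ℝ (Fin d) :=
    fun f => WithLp.toLp 2 fun k => ((f k : ℕ) : ℝ) / m
  have hg : ∀ f, g f ∈ unitCube d := fun f k => by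
    refine ⟨by simp only [g]; positivity, ?_⟩
    simp only [g]
    rw [div_le_one hmpos']
    exact_mod_cast Nat.lt_succ_iff.mp (f k).2
  choose j hj using fun f => hD (g f) (hg f)
  obtain ⟨f, h, hne, hfh⟩ := Fintype.exists_ne_map_eq_of_card_lt j (by simpa using hcard)
  obtain ⟨k, hk⟩ := Function.ne_iff.mp hne
  have hdist : dist (g f) (g h) ≤ 2 * D := by
    have h1 := hj f
    have h2 := hj h
    rw [← hfh] at h2
    linarith [dist_triangle_right (g f) (g h) (s (j f))]
  have hcoord : 1 / (m : ℝ) ≤ dist (g f) (g h) := by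
    refine le_trans ?_ (PiLp.dist_apply_le (g f) (g h) k)
    simp only [g]
    rw [Real.dist_eq, ← sub_div, abs_div, abs_of_pos hmpos']
    gcongr
    have : ((f k : ℕ) : ℤ) - (h k : ℕ) ≠ 0 := by
      intro h0
      apply hk
      ext
      omega
    exact_mod_cast Int.one_le_abs this
  refine le_trans ?_ (hcoord.trans hdist)
  rw [Real.rpow_neg (by positivity), ← one_div]
  gcongr
  exact Nat.floor_le (by positivity)

end Cube

/-! ### Paths and ellipsoids near a segment -/

section Segment

variable {E : Type*} [NormedAddCommGroup E] [InnerProductSpace ℝ E]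

/-- This is `2‖x‖‖x + e‖ ≤ ‖x‖² + ‖x + e‖²`, expanded. The term linear in `e` is kept exactly so
that it can telescope in a sum. -/
lemma norm_add_le_of_ne_zero {x : E} (hx : x ≠ 0) (e : E) :
    ‖x + e‖ ≤ ‖x‖ + inner ℝ x e / ‖x‖ + ‖e‖ ^ 2 / (2 * ‖x‖) := by
  have hx' : 0 < ‖x‖ := norm_pos_iff.mpr hx
  have h := norm_add_sq_real x e
  have h2 : ‖x‖ + inner ℝ x e / ‖x‖ + ‖e‖ ^ 2 / (2 * ‖x‖) =
      (‖x + e‖ ^ 2 + ‖x‖ ^ 2) / (2 * ‖x‖) := by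
    rw [h]
    field_simp
    ring
  rw [h2, le_div_iff₀ (by positivity)]
  nlinarith [sq_nonneg (‖x + e‖ - ‖x‖)]

/-- A polygonal path whose vertices are within `D` of equally spaced points of a segment exceeds
the segment in length only to second order in `D`. -/
lemma sum_dist_le_of_near_segment {x y : E} (hxy : x ≠ y) {N : ℕ} (hN : 0 < N) {p : ℕ → E} {D : ℝ}
    (h0 : p 0 = x) (h1 : p N = y)
    (hp : ∀ k ≤ N, dist (x + ((k : ℝ) / N) • (y - x)) (p k) ≤ D) :
    ∑ k ∈ Finset.range N, dist (p k) (p (k + 1)) ≤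
      dist x y + 2 * N ^ 2 * D ^ 2 / dist x y := by
  have hN' : (0 : ℝ) < N := by exact_mod_cast hN
  set v : E := (1 / (N : ℝ)) • (y - x) with hv
  have hyx : y - x ≠ 0 := sub_ne_zero.mpr hxy.symm
  have hv0 : v ≠ 0 := smul_ne_zero (by positivity) hyx
  have hρ : 0 < dist x y := dist_pos.mpr hxy
  have hvn : ‖v‖ = dist x y / N := by
    rw [hv, norm_smul, dist_comm, dist_eq_norm, Real.norm_of_nonneg (by positivity)]
    ring
  let e : ℕ → E := fun k => p k - (x + ((k : ℝ) / N) • (y - x))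
  have hstep : ∀ k, p (k + 1) - p k = v + (e (k + 1) - e k) := by
    intro k
    simp only [e, hv]
    push_cast
    rw [add_div, add_smul]
    abel
  have he : ∀ k ≤ N, ‖e k‖ ≤ D := fun k hk => by
    have := hp k hk
    rwa [dist_comm, dist_eq_norm] at this
  have he0 : e 0 = 0 := by simp [e, h0]
  have heN : e N = 0 := by simp [e, h1, hN'.ne']
  calc ∑ k ∈ Finset.range N, dist (p k) (p (k + 1))
      ≤ ∑ k ∈ Finset.range N,
        (‖v‖ + inner ℝ v (e (k + 1) - e k) / ‖v‖ + (2 * D) ^ 2 / (2 * ‖v‖)) := by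
        refine Finset.sum_le_sum fun k hk => ?_
        rw [Finset.mem_range] at hk
        rw [dist_comm, dist_eq_norm, hstep]
        refine (norm_add_le_of_ne_zero hv0 _).trans ?_
        gcongr
        linarith [norm_sub_le (e (k + 1)) (e k), he k hk.le, he (k + 1) hk]
    _ = N * ‖v‖ + N * ((2 * D) ^ 2 / (2 * ‖v‖)) := by
        -- The linear terms sum to the inner product of `v` with `e N - e 0`, which vanishes because
        -- the path ends exactly at the foci.
        rw [Finset.sum_add_distrib, Finset.sum_add_distrib, ← Finset.sum_div, ← inner_sum,
          Finset.sum_range_sub, he0, heN]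
        simp
    _ = dist x y + 2 * N ^ 2 * D ^ 2 / dist x y := by
        rw [hvn]
        field_simp

/-- A point of a prolate hyperspheroid is close to the segment between the foci. -/
lemma exists_near_segment_of_dist_add_le {x y z : E} {c : ℝ}
    (hc : dist x z + dist z y ≤ c) :
    ∃ t ∈ Set.Icc (0 : ℝ) 1, dist z (x + t • (y - x)) ^ 2 ≤ (c ^ 2 - dist x y ^ 2) / 4 := by
  set a := dist x z with ha
  set b := dist z y with hb
  have ha0 : 0 ≤ a := dist_nonneg
  have hb0 : 0 ≤ b := dist_nonneg
  have htri : dist x y ≤ a + b := dist_triangle x z y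
  rcases (add_nonneg ha0 hb0).eq_or_lt with h | h
  · refine ⟨0, by simp, ?_⟩
    have ha' : a = 0 := by linarith
    have : dist x y = 0 := le_antisymm (by linarith) dist_nonneg
    rw [this, zero_smul, add_zero, dist_comm, ← ha, ha']
    nlinarith [sq_nonneg c]
  -- The segment is divided in the ratio of the distances of `z` from the foci (Stewart's theorem
  -- gives `h4`).
  · refine ⟨a / (a + b), ⟨by positivity, (div_le_one h).mpr (by linarith)⟩, ?_⟩
    set t := a / (a + b) with ht
    have hxz : ‖z - x‖ = a := by rw [ha, dist_comm, dist_eq_norm]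
    have hxy : ‖y - x‖ = dist x y := by rw [dist_comm, dist_eq_norm]
    have hzy : ‖(z - x) - (y - x)‖ = b := by rw [sub_sub_sub_cancel_right, hb, dist_eq_norm]
    have h1 : dist z (x + t • (y - x)) ^ 2 =
        a ^ 2 - 2 * t * inner ℝ (z - x) (y - x) + t ^ 2 * dist x y ^ 2 := by
      rw [dist_eq_norm, ← sub_sub, norm_sub_sq_real, hxz, norm_smul, mul_pow, hxy,
        inner_smul_right, Real.norm_eq_abs, sq_abs]
      ring
    have h2 := norm_sub_sq_real (z - x) (y - x)
    rw [hzy, hxz, hxy] at h2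
    have h3 : 2 * inner ℝ (z - x) (y - x) = a ^ 2 + dist x y ^ 2 - b ^ 2 := by linarith
    have h4 : dist z (x + t • (y - x)) ^ 2 =
        a * b / (a + b) ^ 2 * ((a + b) ^ 2 - dist x y ^ 2) := by
      rw [h1, mul_right_comm, h3, ht]
      field_simp
      ring
    have h5 : a * b / (a + b) ^ 2 ≤ 1 / 4 := by
      rw [div_le_iff₀ (by positivity)]
      nlinarith [sq_nonneg (a - b)]
    have h6 : 0 ≤ (a + b) ^ 2 - dist x y ^ 2 := by
      nlinarith [dist_nonneg (x := x) (y := y)]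
    have h7 : (a + b) ^ 2 ≤ c ^ 2 := by gcongr
    rw [h4]
    nlinarith

end Segment

/-! ### Shortest paths in disk graphs -/

section Walks

variable {d n : ℕ} {s : Fin n → EuclideanSpace ℝ (Fin d)}

lemma walkCost_cons {G : SimpleGraph (Fin n)} {u v w : Fin n} (h : G.Adj u v)
    (p : G.Walk v w) : walkCost s (.cons h p) = edist (s u) (s v) + walkCost s p := by
  simp [walkCost]

lemma walkCost_append {G : SimpleGraph (Fin n)} {u v w : Fin n} (p : G.Walk u v)
    (q : G.Walk v w) : walkCost s (p.append q) = walkCost s p + walkCost s q := by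
  simp [walkCost, SimpleGraph.Walk.darts_append]

lemma edist_le_walkCost {G : SimpleGraph (Fin n)} {u v : Fin n} (p : G.Walk u v) :
    edist (s u) (s v) ≤ walkCost s p := by
  induction p with
  | nil => simp
  | @cons u w v h p ih =>
    refine (edist_triangle _ (s w) _).trans ?_
    rw [walkCost_cons]
    gcongr

lemma mem_informedSet_of_mem_support {G : SimpleGraph (Fin n)} {u v w : Fin n} (p : G.Walk u v)
    (hw : w ∈ p.support) : s w ∈ informedSet (s u) (s v) (walkCost s p) := by
  classical
  change edist (s u) (s w) + edist (s w) (s v) ≤ walkCost s p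
  rw [← p.take_spec hw, walkCost_append]
  exact add_le_add (edist_le_walkCost _) (edist_le_walkCost _)

/-- A path repeats no dart, so containment of its darts already holds with multiplicity. -/
lemma walkCost_bypass_le {G : SimpleGraph (Fin n)} {u v : Fin n} (p : G.Walk u v) :
    walkCost s p.bypass ≤ walkCost s p := by
  have hnd : p.bypass.darts.Nodup :=
    SimpleGraph.Walk.darts_nodup_of_support_nodup p.bypass_isPath.support_nodup
  have hsub := List.Nodup.subperm hnd p.darts_bypass_subset_darts
  obtain ⟨l, hl, hls⟩ := hsub
  rw [walkCost, walkCost, ← (hl.map _).sum_eq]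
  exact (hls.map _).sum_le_sum (fun _ _ => zero_le)

/-- Paths, unlike walks, are finite in number, and shortcutting a walk to a path costs nothing. -/
lemma exists_walkCost_eq_shortestCost {G : SimpleGraph (Fin n)} {u v : Fin n}
    (h : Nonempty (G.Walk u v)) : ∃ p : G.Walk u v, walkCost s p = shortestCost s G u v := by
  classical
  have hne : Nonempty (G.Path u v) := h.map fun p => p.toPath
  obtain ⟨p, hp⟩ := exists_eq_ciInf_of_finite (f := fun p : G.Path u v => walkCost s p.1)
  refine ⟨p.1, le_antisymm ?_ (iInf_le _ _)⟩
  refine le_iInf fun q => ?_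
  rw [hp]
  exact (iInf_le _ q.toPath).trans (walkCost_bypass_le q)

lemma shortestCost_diskGraph_le_walkCost {V W : Finset (Fin n)} {r r' : ℝ} (hr : r ≤ r')
    {u v : Fin n} (p : (diskGraph s V r).Walk u v) (hp : ∀ w ∈ p.support, w ∈ W) :
    shortestCost s (diskGraph s W r') u v ≤ walkCost s p := by
  suffices ∃ q : (diskGraph s W r').Walk u v, walkCost s q = walkCost s p by
    obtain ⟨q, hq⟩ := this
    exact hq ▸ iInf_le _ q
  induction p with
  | nil => exact ⟨.nil, rfl⟩
  | @cons u w v h p ih =>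
    simp only [SimpleGraph.Walk.support_cons, List.mem_cons, forall_eq_or_imp] at hp
    obtain ⟨q, hq⟩ := ih hp.2
    have hadj : (diskGraph s W r').Adj u w :=
      ⟨h.1, hp.1, hp.2 _ p.start_mem_support, h.2.2.2.trans hr⟩
    exact ⟨.cons hadj q, by rw [walkCost_cons, walkCost_cons, hq]⟩

lemma shortestCost_le_sum_edist {r : ℝ} {N : ℕ} (q : ℕ → Fin n)
    (hq : ∀ k < N, dist (s (q k)) (s (q (k + 1))) ≤ r) :
    shortestCost s (diskGraph s Finset.univ r) (q 0) (q N) ≤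
      ∑ k ∈ Finset.range N, edist (s (q k)) (s (q (k + 1))) := by
  suffices ∃ p : (diskGraph s Finset.univ r).Walk (q 0) (q N),
      walkCost s p ≤ ∑ k ∈ Finset.range N, edist (s (q k)) (s (q (k + 1))) by
    obtain ⟨p, hp⟩ := this
    exact (iInf_le _ p).trans hp
  induction N with
  | zero => exact ⟨.nil, by simp [walkCost]⟩
  | succ N ih =>
    obtain ⟨p, hp⟩ := ih fun k hk => hq k (by omega)
    rw [Finset.sum_range_succ]
    -- Neighbouring points of the segment may share a sample; such a step is no edge and is skipped.
    by_cases h : q N = q (N + 1)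
    · refine ⟨p.copy rfl h, ?_⟩
      rw [walkCost, SimpleGraph.Walk.darts_copy]
      exact hp.trans le_self_add
    · have hadj : (diskGraph s Finset.univ r).Adj (q N) (q (N + 1)) :=
        ⟨h, Finset.mem_univ _, Finset.mem_univ _, hq N (by omega)⟩
      refine ⟨p.append (.cons hadj .nil), ?_⟩
      rw [walkCost_append]
      gcongr
      simp [walkCost]

/-- A disk graph on samples that cover the cube up to distance `D` contains paths that are
shortest up to a relative error of order `(D / r) ^ 2`. -/
lemma shortestCost_diskGraph_le (hs : ∀ j, s j ∈ unitCube d) {D r : ℝ} (hr : 0 < r)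
    (hD : ∀ x ∈ unitCube d, ∃ j, dist x (s j) ≤ D) (hDr : 4 * D ≤ r) (a b : Fin n) :
    shortestCost s (diskGraph s Finset.univ r) a b ≤
      ENNReal.ofReal (dist (s a) (s b) * (1 + 18 * (D / r) ^ 2)) := by
  have hD0 : 0 ≤ D := by
    obtain ⟨j, hj⟩ := hD _ (hs a)
    exact dist_nonneg.trans hj
  set ρ := dist (s a) (s b) with hρ
  rcases le_or_gt ρ r with h | h
  · have := shortestCost_le_sum_edist (s := s) (r := r) (N := 1) (fun k => if k = 0 then a else b)
      (by intro k hk; simpa [Nat.lt_one_iff.mp hk] using h)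
    simp only [↓reduceIte, one_ne_zero, Finset.range_one, Finset.sum_singleton, zero_add] at this
    refine this.trans ?_
    rw [edist_dist, ← hρ]
    apply ENNReal.ofReal_le_ofReal
    have : 0 ≤ ρ * (18 * (D / r) ^ 2) := by positivity
    linarith
  · have hρ0 : 0 < ρ := hr.trans h
    -- Spacing at most `r / 2` leaves room for an error `D ≤ r / 4` at both ends of an edge. The
    -- bound `N ≤ 3ρ / r` turns `2 N² D²` into the constant 18.
    set N := ⌈2 * ρ / r⌉₊ with hN
    have hN0 : 0 < N := Nat.ceil_pos.mpr (by positivity)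
    have hN0' : (0 : ℝ) < N := by exact_mod_cast hN0
    have hNl : 2 * ρ / r ≤ N := Nat.le_ceil _
    have hNu : (N : ℝ) ≤ 3 * ρ / r := by
      have h1 : (N : ℝ) < 2 * ρ / r + 1 := Nat.ceil_lt_add_one (by positivity)
      have h2 : 1 ≤ ρ / r := (one_le_div hr).mpr h.le
      have h3 : 3 * ρ / r = 2 * ρ / r + ρ / r := by ring
      linarith
    have hseg : ∀ k ≤ N, s a + ((k : ℝ) / N) • (s b - s a) ∈ unitCube d := fun k hk =>
      add_smul_sub_mem_unitCube (hs a) (hs b) (by positivity)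
        ((div_le_one hN0').mpr (by exact_mod_cast hk))
    -- The endpoints are pinned to `a` and `b`; the choice for `k > N` is arbitrary.
    have hex : ∀ k : ℕ, ∃ j : Fin n, (k = 0 → j = a) ∧ (k = N → j = b) ∧
        (k ≤ N → dist (s a + ((k : ℝ) / N) • (s b - s a)) (s j) ≤ D) := by
      intro k
      rcases Nat.eq_zero_or_pos k with rfl | hk
      · exact ⟨a, fun _ => rfl, fun h => absurd h hN0.ne, fun _ => by simpa using hD0⟩
      by_cases hkN : k = N
      · refine ⟨b, by omega, fun _ => rfl, fun _ => ?_⟩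
        rw [hkN, div_self hN0'.ne']
        simpa using hD0
      by_cases hle : k ≤ N
      · obtain ⟨j, hj⟩ := hD _ (hseg k hle)
        exact ⟨j, by omega, by omega, fun _ => hj⟩
      · exact ⟨a, by omega, by omega, by omega⟩
    choose q hq0 hqN hqD using hex
    have hstep : ∀ k < N, dist (s (q k)) (s (q (k + 1))) ≤ r := by
      intro k hk
      have h1 := hqD k hk.le
      have h2 := hqD (k + 1) hk
      have h3 : dist (s a + ((k : ℝ) / N) • (s b - s a))
          (s a + (((k + 1 : ℕ) : ℝ) / N) • (s b - s a)) = ρ / N := by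
        rw [dist_add_left, dist_eq_norm, ← sub_smul, norm_smul, hρ, dist_comm (s a),
          dist_eq_norm (s b)]
        have : (k : ℝ) / N - ((k + 1 : ℕ) : ℝ) / N = -(1 / N) := by push_cast; ring
        rw [this, norm_neg, Real.norm_of_nonneg (by positivity)]
        ring
      have h4 : ρ / N ≤ r / 2 := by
        rw [div_le_iff₀ hN0']
        rw [div_le_iff₀ hr] at hNl
        linarith
      rw [dist_comm] at h1
      have := dist_triangle4 (s (q k)) _ _ (s (q (k + 1))) |>.trans
        (add_le_add (add_le_add h1 h3.le) h2)
      linarith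
    have hcost := shortestCost_le_sum_edist q hstep
    rw [hq0 0 rfl, hqN N rfl] at hcost
    refine hcost.trans ?_
    have hsum := sum_dist_le_of_near_segment (p := fun k => s (q k)) (D := D)
      (dist_pos.mp hρ0) hN0 (by simp [hq0 0 rfl]) (by simp [hqN N rfl]) hqD
    simp only [edist_dist]
    rw [← ENNReal.ofReal_sum_of_nonneg fun _ _ => dist_nonneg]
    apply ENNReal.ofReal_le_ofReal
    refine hsum.trans ?_
    rw [← hρ, mul_add, mul_one]
    gcongr
    rw [div_le_iff₀ hρ0]
    have : (N : ℝ) ^ 2 ≤ (3 * ρ / r) ^ 2 := by gcongr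
    calc 2 * (N : ℝ) ^ 2 * D ^ 2 ≤ 2 * (3 * ρ / r) ^ 2 * D ^ 2 := by gcongr
      _ = ρ * (18 * (D / r) ^ 2) * ρ := by ring

end Walks

/-! ### Pruning preserves good paths -/

section Pruning

variable {d n : ℕ} {s : Fin n → EuclideanSpace ℝ (Fin d)}

lemma one_lt_two_rpow (hd : 1 ≤ d) : (1 : ℝ) < 2 ^ (1 / (d : ℝ)) :=
  Real.one_lt_rpow one_lt_two (by positivity)

lemma radius_eq (d : ℕ) (r₀ : ℝ) (i : ℕ) :
    radius d r₀ i = ((2 : ℝ) ^ (1 / (d : ℝ))) ^ i * r₀ := by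
  induction i with
  | zero => simp [radius]
  | succ i ih => rw [radius, ih, pow_succ]; ring

lemma radius_le_succ (hd : 1 ≤ d) {r₀ : ℝ} (hr : 0 ≤ r₀) (i : ℕ) :
    radius d r₀ i ≤ radius d r₀ (i + 1) := by
  have hq := one_lt_two_rpow hd
  rw [radius_eq, radius_eq]
  gcongr
  · exact hq.le
  · omega

lemma mem_activeVertices_iff {a b v : Fin n} {r₀ : ℝ} {i : ℕ} :
    v ∈ activeVertices s a b r₀ i ↔ ∀ j < i,
      s v ∈ informedSet (s a) (s b) (shortestCost s (batchGraph s a b r₀ j) a b) := by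
  induction i with
  | zero => simp [activeVertices]
  | succ i ih =>
    simp only [activeVertices, Finset.mem_filter, ih, Order.lt_add_one_iff]
    constructor
    · rintro ⟨h1, h2⟩ j hj
      rcases hj.lt_or_eq with h | rfl
      · exact h1 j h
      · exact h2
    · exact fun h => ⟨fun j hj => h j hj.le, h i le_rfl⟩

lemma edist_le_shortestCost (G : SimpleGraph (Fin n)) (a b : Fin n) :
    edist (s a) (s b) ≤ shortestCost s G a b :=
  le_iInf fun p => edist_le_walkCost p

lemma start_mem_activeVertices (a b : Fin n) (r₀ : ℝ) (i : ℕ) :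
    a ∈ activeVertices s a b r₀ i := by
  rw [mem_activeVertices_iff]
  intro j _
  change edist (s a) (s a) + edist (s a) (s b) ≤ _
  rw [edist_self, zero_add]
  exact edist_le_shortestCost _ _ _

lemma mem_of_mem_support_diskGraph {V : Finset (Fin n)} {r : ℝ} {u v w : Fin n}
    (p : (diskGraph s V r).Walk u v) (hu : u ∈ V) (hw : w ∈ p.support) : w ∈ V := by
  induction p with
  | nil => simpa [List.mem_singleton.mp hw] using hu
  | cons h p ih =>
    rcases List.mem_cons.mp hw with rfl | hw
    · exact hu
    · exact ih h.2.2.1 hw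

lemma informedSet_mono {x y : EuclideanSpace ℝ (Fin d)} {c c' : ℝ≥0∞} (h : c ≤ c') :
    informedSet x y c ⊆ informedSet x y c' := fun _ hz => le_trans hz h

/-- An optimal path of one batch lies in its own informed set, so it survives the pruning and is
available at the next, larger radius. -/
lemma shortestCost_batchGraph_antitone (hd : 1 ≤ d) (a b : Fin n) {r₀ : ℝ} (hr : 0 ≤ r₀) :
    Antitone fun i => shortestCost s (batchGraph s a b r₀ i) a b := by
  refine antitone_nat_of_succ_le fun i => ?_
  rcases isEmpty_or_nonempty ((batchGraph s a b r₀ i).Walk a b) with h | h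
  · rw [shortestCost.eq_def s (batchGraph s a b r₀ i), iInf_of_empty]
    exact le_top
  · obtain ⟨p, hp⟩ := exists_walkCost_eq_shortestCost (s := s) h
    rw [← hp]
    refine shortestCost_diskGraph_le_walkCost (radius_le_succ hd hr i) p fun w hw => ?_
    have hwi := mem_of_mem_support_diskGraph p (start_mem_activeVertices a b r₀ i) hw
    rw [mem_activeVertices_iff] at hwi ⊢
    intro j hj
    rcases (Nat.lt_succ_iff.mp hj).lt_or_eq with h | rfl
    · exact hwi j h
    · rw [← hp]
      exact mem_informedSet_of_mem_support p hw

/-- Pruning does not increase the cost of a shortest path. -/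
lemma shortestCost_batchGraph_le (hd : 1 ≤ d) (a b : Fin n) {r₀ : ℝ} (hr : 0 ≤ r₀) (i : ℕ) :
    shortestCost s (batchGraph s a b r₀ i) a b ≤
      shortestCost s (diskGraph s Finset.univ (radius d r₀ i)) a b := by
  refine le_iInf fun p => ?_
  -- Either the walk beats no earlier cost strictly from above, and all its vertices survive, or
  -- some earlier batch already found something cheaper, and costs only decrease.
  by_cases h : ∀ j < i, walkCost s p ≤ shortestCost s (batchGraph s a b r₀ j) a b
  · refine shortestCost_diskGraph_le_walkCost le_rfl p fun w hw => ?_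
    rw [mem_activeVertices_iff]
    exact fun j hj => informedSet_mono (h j hj) (mem_informedSet_of_mem_support p hw)
  · push Not at h
    obtain ⟨j, hj, hlt⟩ := h
    exact (shortestCost_batchGraph_antitone hd a b hr hj.le).trans hlt.le

end Pruning

/-! ### Counting edges and samples in a tube -/

section Counting

variable {d n : ℕ} {s : Fin n → EuclideanSpace ℝ (Fin d)} {K : ℝ}

lemma SpreadOut.nonneg (hK : SpreadOut K s) (hs : ∀ j, s j ∈ unitCube d) (hn : 1 ≤ n) :
    0 ≤ K := by
  have hn' : (0 : ℝ) < n := by exact_mod_cast hn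
  have h := hK _ (hs ⟨0, hn⟩) _ le_rfl
  by_contra! hneg
  have : K * n * ((n : ℝ) ^ (-(1 / (d : ℝ)))) ^ d < 0 :=
    mul_neg_of_neg_of_pos (mul_neg_of_neg_of_pos hneg hn') (by positivity)
  exact absurd (h.trans_lt this) (not_lt.mpr (Nat.cast_nonneg _))

lemma ncard_edgeSet_diskGraph_le (hK : SpreadOut K s) (hs : ∀ j, s j ∈ unitCube d)
    (V : Finset (Fin n)) {r : ℝ} (hr : (n : ℝ) ^ (-(1 / (d : ℝ))) ≤ r) :
    ((diskGraph s V r).edgeSet.ncard : ℝ) ≤ V.card * (K * n * r ^ d) := by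
  have hsub : (diskGraph s V r).edgeSet ⊆
      ⋃ v ∈ V, (fun u => s(v, u)) '' {u | dist (s u) (s v) ≤ r} := by
    intro e he
    induction e with
    | _ u v =>
      have h : (diskGraph s V r).Adj u v := he
      simp only [Set.mem_iUnion]
      exact ⟨u, h.2.1, v, by rw [Set.mem_ofPred_eq, dist_comm]; exact h.2.2.2, rfl⟩
  have h1 := (Set.ncard_le_ncard hsub (Set.toFinite _)).trans (Finset.set_ncard_biUnion_le _ _)
  calc ((diskGraph s V r).edgeSet.ncard : ℝ)
      ≤ ∑ v ∈ V, (((fun u => s(v, u)) '' {u | dist (s u) (s v) ≤ r}).ncard : ℝ) := by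
        exact_mod_cast h1
    _ ≤ ∑ _v ∈ V, K * n * r ^ d := by
        refine Finset.sum_le_sum fun v _ => ?_
        refine le_trans ?_ (hK _ (hs v) r hr)
        exact_mod_cast Set.ncard_image_le (Set.toFinite _)
    _ = V.card * (K * n * r ^ d) := by rw [Finset.sum_const, nsmul_eq_mul]

/-- Rounding `t` down to a multiple of `1/N` moves the point by at most `√d / N ≤ w`, so `N + 1`
balls of radius `2w` cover the tube. -/
lemma card_le_of_near_segment (hK : SpreadOut K s) (hs : ∀ j, s j ∈ unitCube d) (a b : Fin n)
    {V : Finset (Fin n)} {w : ℝ} {N : ℕ} (hN : 0 < N) (hNw : √(d : ℝ) / N ≤ w)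
    (hw : (n : ℝ) ^ (-(1 / (d : ℝ))) ≤ 2 * w)
    (hV : ∀ v ∈ V, ∃ t ∈ Set.Icc (0 : ℝ) 1, dist (s v) (s a + t • (s b - s a)) ≤ w) :
    (V.card : ℝ) ≤ (N + 1) * (K * n * (2 * w) ^ d) := by
  have hN' : (0 : ℝ) < N := by exact_mod_cast hN
  let p : ℕ → EuclideanSpace ℝ (Fin d) := fun k => s a + ((k : ℝ) / N) • (s b - s a)
  have hp : ∀ k ∈ Finset.range (N + 1), p k ∈ unitCube d := fun k hk =>
    add_smul_sub_mem_unitCube (hs a) (hs b) (by positivity)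
      ((div_le_one hN').mpr (by exact_mod_cast Finset.mem_range_succ_iff.mp hk))
  have hsub : (V : Set (Fin n)) ⊆
      ⋃ k ∈ Finset.range (N + 1), {j | dist (s j) (p k) ≤ 2 * w} := by
    intro v hv
    obtain ⟨t, ⟨h0, h1⟩, ht⟩ := hV v hv
    have hle : (⌊t * N⌋₊ : ℝ) ≤ t * N := Nat.floor_le (by positivity)
    have hlt : t * N < ⌊t * N⌋₊ + 1 := Nat.lt_floor_add_one _
    simp only [Set.mem_iUnion]
    refine ⟨⌊t * N⌋₊, ?_, ?_⟩
    · rw [Finset.mem_range_succ_iff]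
      have : (⌊t * N⌋₊ : ℝ) ≤ N := hle.trans (mul_le_of_le_one_left hN'.le h1)
      exact_mod_cast this
    · have hdist : dist (s a + t • (s b - s a)) (p ⌊t * N⌋₊) ≤ √(d : ℝ) / N := by
        have h2 : t - (⌊t * N⌋₊ : ℝ) / N = (t * N - ⌊t * N⌋₊) / N := by field_simp
        rw [dist_add_left, dist_eq_norm, ← sub_smul, norm_smul, ← dist_eq_norm (s b), h2,
          Real.norm_of_nonneg (div_nonneg (by linarith) hN'.le), div_mul_eq_mul_div]
        gcongr
        calc (t * N - ⌊t * N⌋₊) * dist (s b) (s a) ≤ 1 * dist (s b) (s a) := by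
              gcongr
              linarith
          _ ≤ √(d : ℝ) := by
              rw [one_mul]
              exact dist_le_sqrt_of_mem_unitCube (hs b) (hs a)
      change dist _ _ ≤ _
      linarith [dist_triangle (s v) (s a + t • (s b - s a)) (p ⌊t * N⌋₊)]
  have h1 := (Set.ncard_le_ncard hsub (Set.toFinite _)).trans (Finset.set_ncard_biUnion_le _ _)
  rw [Set.ncard_coe_finset] at h1
  calc (V.card : ℝ)
      ≤ ∑ k ∈ Finset.range (N + 1), (({j | dist (s j) (p k) ≤ 2 * w}.ncard : ℕ) : ℝ) := by
        exact_mod_cast h1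
    _ ≤ ∑ _k ∈ Finset.range (N + 1), K * n * (2 * w) ^ d :=
        Finset.sum_le_sum fun k hk => hK _ (hp k hk) _ hw
    _ = (N + 1) * (K * n * (2 * w) ^ d) := by
        rw [Finset.sum_const, nsmul_eq_mul, Finset.card_range]
        push_cast
        ring

end Counting

/-! ### Number of batches and total work -/

section Search

variable {d n : ℕ} {s : Fin n → EuclideanSpace ℝ (Fin d)} {K R r₀ : ℝ} {a b : Fin n}

lemma two_rpow_pow (hd : 1 ≤ d) : ((2 : ℝ) ^ (1 / (d : ℝ))) ^ d = 2 := by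
  rw [one_div]
  exact Real.rpow_inv_natCast_pow zero_le_two (by omega)

lemma pow_lt_of_lt_sInf {T : ℝ} (hT : 0 < T) (hr : T⁻¹ ≤ r₀) {i : ℕ}
    (hi : i < sInf {i : ℕ | √(d : ℝ) ≤ radius d r₀ i}) :
    ((2 : ℝ) ^ (1 / (d : ℝ))) ^ i < √(d : ℝ) * T := by
  have h := Nat.notMem_of_lt_sInf hi
  rw [Set.mem_ofPred_eq, not_le, radius_eq] at h
  rw [← div_lt_iff₀ hT, div_eq_mul_inv]
  exact lt_of_le_of_lt (by gcongr) h

/-- The batch before the last still has radius below `√d`, and one more step costs a factor `q`. The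
case `0` is trivial, so it need not be shown that the radii ever reach `√d`. -/
lemma pow_sInf_le (hd : 1 ≤ d) {T : ℝ} (hT : 1 ≤ T) (hr : T⁻¹ ≤ r₀) :
    ((2 : ℝ) ^ (1 / (d : ℝ))) ^ (sInf {i : ℕ | √(d : ℝ) ≤ radius d r₀ i}) ≤
      (2 : ℝ) ^ (1 / (d : ℝ)) * √(d : ℝ) * T := by
  have hq := one_lt_two_rpow hd
  have hd1 : 1 ≤ √(d : ℝ) := Real.one_le_sqrt.mpr (by exact_mod_cast hd)
  have hlt := fun i => pow_lt_of_lt_sInf (d := d) (by linarith : 0 < T) hr (i := i)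
  generalize sInf {i : ℕ | √(d : ℝ) ≤ radius d r₀ i} = m at hlt
  cases m with
  | zero =>
    rw [pow_zero]
    exact one_le_mul_of_one_le_of_one_le (one_le_mul_of_one_le_of_one_le hq.le hd1) hT
  | succ m =>
    rw [pow_succ', mul_assoc]
    gcongr
    exact (hlt m (by omega)).le

lemma numBatches_le (hd : 1 ≤ d) (hn : 1 ≤ n) (hr : ((n : ℝ) ^ (1 / (d : ℝ)))⁻¹ ≤ r₀) :
    (numBatches d r₀ : ℝ) ≤
      (1 + d * Real.log ((2 : ℝ) ^ (1 / (d : ℝ)) * √(d : ℝ)) / Real.log 2 + 1 / Real.log 2) *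
        (1 + Real.log n) := by
  have hn1 : (1 : ℝ) ≤ n := by exact_mod_cast hn
  have hn0 : (0 : ℝ) < n := by linarith
  have hd0 : (0 : ℝ) < d := by exact_mod_cast hd
  have hq := one_lt_two_rpow hd
  have hd1 : 1 ≤ √(d : ℝ) := Real.one_le_sqrt.mpr (by exact_mod_cast hd)
  have h2 : 0 < Real.log 2 := Real.log_pos one_lt_two
  have hT : 1 ≤ (n : ℝ) ^ (1 / (d : ℝ)) := Real.one_le_rpow hn1 (by positivity)
  have hL : 0 ≤ Real.log ((2 : ℝ) ^ (1 / (d : ℝ)) * √(d : ℝ)) :=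
    Real.log_nonneg (one_le_mul_of_one_le_of_one_le hq.le hd1)
  have hln : 0 ≤ Real.log n := Real.log_nonneg hn1
  have h := Real.log_le_log (by positivity) (pow_sInf_le hd hT hr)
  rw [Real.log_pow, Real.log_mul (by positivity) (by positivity), Real.log_rpow two_pos,
    Real.log_rpow hn0] at h
  rw [numBatches, Nat.cast_add, Nat.cast_one]
  set m : ℝ := ((sInf {i : ℕ | √(d : ℝ) ≤ radius d r₀ i} : ℕ) : ℝ)
  set l := Real.log ((2 : ℝ) ^ (1 / (d : ℝ)) * √(d : ℝ))
  have h3 : m ≤ d * l / Real.log 2 + 1 / Real.log 2 * Real.log n := by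
    have h4 : m * Real.log 2 ≤ d * l + Real.log n := by
      have := mul_le_mul_of_nonneg_left h hd0.le
      field_simp at this
      linarith
    rw [← le_div_iff₀ h2] at h4
    refine h4.trans_eq ?_
    ring
  have h5 : 0 ≤ d * l / Real.log 2 * Real.log n := by positivity
  have h6 : 0 ≤ 1 / Real.log 2 := by positivity
  nlinarith

/-- After the first `d` batches, the samples in use lie in a thin neighbourhood of the segment from
the start to the target, whose width is inversely proportional to the radius of the last batch. -/
lemma exists_near_segment_of_mem_activeVertices (hd : 1 ≤ d) (hs : ∀ j, s j ∈ unitCube d)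
    (hr : 0 < r₀) (hD : 2 * dispersion s ≤ r₀) {i : ℕ} (hi : d ≤ i) {v : Fin n}
    (hv : v ∈ activeVertices s a b r₀ (i + 1)) :
    ∃ t ∈ Set.Icc (0 : ℝ) 1, dist (s v) (s a + t • (s b - s a)) ≤
      3 * √(d : ℝ) / ((2 : ℝ) ^ (1 / (d : ℝ))) ^ i := by
  have hq := one_lt_two_rpow hd
  -- Since `q^d = 2`, waiting `d` batches doubles the radius, upgrading `2D ≤ r₀` to the `4D ≤ r_i`
  -- that the path construction needs.
  have hq2 : (2 : ℝ) ≤ ((2 : ℝ) ^ (1 / (d : ℝ))) ^ i :=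
    (two_rpow_pow hd).symm.le.trans (pow_le_pow_right₀ hq.le hi)
  have : Nonempty (Fin n) := ⟨a⟩
  set D := dispersion s with hDdef
  have hcover : ∀ x ∈ unitCube d, ∃ j, dist x (s j) ≤ D :=
    fun x hx => exists_dist_le_dispersion hs hx
  have hD0 : 0 ≤ D := by
    obtain ⟨j, hj⟩ := hcover _ (hs a)
    exact dist_nonneg.trans hj
  have hrad := radius_eq d r₀ i
  set Q := ((2 : ℝ) ^ (1 / (d : ℝ))) ^ i with hQ
  set ρ := dist (s a) (s b) with hρ
  have hρd : ρ ≤ √(d : ℝ) := dist_le_sqrt_of_mem_unitCube (hs a) (hs b)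
  have hrpos : 0 < radius d r₀ i := by rw [hrad]; positivity
  have h4D : 4 * D ≤ radius d r₀ i := by rw [hrad]; nlinarith
  set η := D / radius d r₀ i with hη
  have hη0 : 0 ≤ η := by positivity
  have hη4 : η ≤ 1 / 4 := by rw [hη, div_le_iff₀ hrpos]; linarith
  have hηQ : η ≤ 1 / (2 * Q) := by
    rw [hη, hrad, div_le_div_iff₀ (by positivity) (by positivity)]
    nlinarith
  have hc := ((mem_activeVertices_iff.mp hv i (by omega)).trans
    (shortestCost_batchGraph_le hd a b hr.le i)).trans
      (shortestCost_diskGraph_le hs hrpos hcover h4D a b)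
  rw [edist_dist, edist_dist, ← ENNReal.ofReal_add dist_nonneg dist_nonneg,
    ENNReal.ofReal_le_ofReal_iff (by positivity)] at hc
  obtain ⟨t, ht, hdist⟩ := exists_near_segment_of_dist_add_le hc
  refine ⟨t, ht, ?_⟩
  rw [← hρ, ← hη] at hdist
  refine le_of_sq_le_sq (hdist.trans ?_) (by positivity)
  calc ((ρ * (1 + 18 * η ^ 2)) ^ 2 - ρ ^ 2) / 4 = ρ ^ 2 * η ^ 2 * (9 + 81 * η ^ 2) := by ring
    _ ≤ √(d : ℝ) ^ 2 * (1 / (2 * Q)) ^ 2 * (9 + 81 * (1 / 4) ^ 2) := by gcongr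
    _ ≤ √(d : ℝ) ^ 2 * (1 / (2 * Q)) ^ 2 * 36 := by gcongr; norm_num
    _ = (3 * √(d : ℝ) / Q) ^ 2 := by field_simp; norm_num

lemma ncard_edgeSet_batchGraph_le (hd : 1 ≤ d) (hs : ∀ j, s j ∈ unitCube d) (hK : SpreadOut K s)
    (hr : ((n : ℝ) ^ (1 / (d : ℝ)))⁻¹ ≤ r₀) (hD : 2 * dispersion s ≤ r₀)
    (hR : r₀ ≤ R * ((n : ℝ) ^ (1 / (d : ℝ)))⁻¹) {i : ℕ} (hi : i < numBatches d r₀) :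
    ((batchGraph s a b r₀ i).edgeSet.ncard : ℝ) ≤
      (6 * K ^ 2 * (6 * √(d : ℝ)) ^ d * R ^ d + 2 ^ d * K * R ^ d) * n *
        ((2 : ℝ) ^ (1 / (d : ℝ))) ^ i := by
  have hn : 1 ≤ n := a.pos
  have hn1 : (1 : ℝ) ≤ n := by exact_mod_cast hn
  have hK0 : 0 ≤ K := hK.nonneg hs hn
  have hq := one_lt_two_rpow hd
  have hqd := two_rpow_pow hd
  have hd1 : 1 ≤ √(d : ℝ) := Real.one_le_sqrt.mpr (by exact_mod_cast hd)
  have hneg : (n : ℝ) ^ (-(1 / (d : ℝ))) = ((n : ℝ) ^ (1 / (d : ℝ)))⁻¹ :=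
    Real.rpow_neg (by positivity) _
  have hT : 1 ≤ (n : ℝ) ^ (1 / (d : ℝ)) := Real.one_le_rpow hn1 (by positivity)
  have hTd : ((n : ℝ) ^ (1 / (d : ℝ))) ^ d = n := by
    rw [one_div]
    exact Real.rpow_inv_natCast_pow (by positivity) (by omega)
  have hlt := fun i => pow_lt_of_lt_sInf (d := d) (by linarith) hr (i := i)
  have hrad := radius_eq d r₀
  set T := (n : ℝ) ^ (1 / (d : ℝ)) with hTdef
  set q := (2 : ℝ) ^ (1 / (d : ℝ)) with hqdef
  have hT0 : 0 < T := by linarith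
  have hr0 : 0 < r₀ := lt_of_lt_of_le (by positivity) hr
  have hR0 : 0 ≤ R := by
    by_contra! h
    exact absurd (hr0.trans_le hR) (not_lt.mpr (mul_nonpos_of_nonpos_of_nonneg h.le (by positivity)))
  have hqi : ∀ i, 1 ≤ q ^ i := fun i => one_le_pow₀ hq.le
  have hedge : ((batchGraph s a b r₀ i).edgeSet.ncard : ℝ) ≤
      (activeVertices s a b r₀ i).card * (K * R ^ d * (q ^ i) ^ d) := by
    have hri : (n : ℝ) ^ (-(1 / (d : ℝ))) ≤ radius d r₀ i := by
      rw [hneg, hrad]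
      nlinarith [hqi i]
    refine (ncard_edgeSet_diskGraph_le hK hs _ hri).trans ?_
    gcongr _ * ?_
    calc K * n * radius d r₀ i ^ d ≤ K * n * (q ^ i * (R * T⁻¹)) ^ d := by
          rw [hrad]
          gcongr
      _ = K * R ^ d * (q ^ i) ^ d := by
          rw [mul_pow, mul_pow, inv_pow, hTd]
          field_simp
  -- Up to batch `d` no pruning is needed, as the degrees are bounded. Later, batch `j + 1` profits
  -- from the pruning after batch `j ≥ d`.
  rcases le_or_gt i d with h | h
  · have h1 : ((activeVertices s a b r₀ i).card : ℝ) ≤ n := by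
      exact_mod_cast (Finset.card_le_univ _).trans_eq (Fintype.card_fin n)
    have h2 : (q ^ i) ^ d ≤ 2 ^ d := by
      rw [← pow_mul, mul_comm, pow_mul, hqd]
      exact pow_le_pow_right₀ one_le_two h
    calc ((batchGraph s a b r₀ i).edgeSet.ncard : ℝ)
        ≤ n * (K * R ^ d * 2 ^ d) * 1 := by
          rw [mul_one]
          refine hedge.trans ?_
          gcongr
      _ ≤ n * (K * R ^ d * 2 ^ d) * q ^ i := by gcongr; exact hqi i
      _ ≤ (6 * K ^ 2 * (6 * √(d : ℝ)) ^ d * R ^ d + 2 ^ d * K * R ^ d) * n * q ^ i := by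
          rw [mul_comm _ (n : ℝ)]
          gcongr
          have : 0 ≤ 6 * K ^ 2 * (6 * √(d : ℝ)) ^ d * R ^ d := by positivity
          linarith
  · obtain ⟨j, rfl⟩ : ∃ j, i = j + 1 := ⟨i - 1, by omega⟩
    -- Batch `j` is not the last, so the tube of width `3√d / q^j` is not thinner than the scale at
    -- which `SpreadOut` applies.
    have hj : q ^ j < √(d : ℝ) * T := hlt j (by rw [numBatches] at hi; omega)
    have hqj := hqi j
    have hN0 : 0 < ⌈q ^ j⌉₊ := Nat.ceil_pos.mpr (by positivity)
    have hNle : q ^ j ≤ ⌈q ^ j⌉₊ := Nat.le_ceil _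
    have hNlt : (⌈q ^ j⌉₊ : ℝ) < q ^ j + 1 := Nat.ceil_lt_add_one (by positivity)
    have hcard := card_le_of_near_segment hK hs a b (V := activeVertices s a b r₀ (j + 1))
      (w := 3 * √(d : ℝ) / q ^ j) hN0
      (by
        gcongr
        linarith)
      (by
        rw [hneg, inv_le_comm₀ hT0 (by positivity), ← mul_div_assoc, inv_div,
          div_le_iff₀ (by positivity)]
        nlinarith)
      (fun v hv => exists_near_segment_of_mem_activeVertices hd hs hr0 hD (by omega) hv)
    calc ((batchGraph s a b r₀ (j + 1)).edgeSet.ncard : ℝ)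
        ≤ (3 * q ^ j * (K * n * (2 * (3 * √(d : ℝ) / q ^ j)) ^ d)) *
            (K * R ^ d * (q ^ (j + 1)) ^ d) := by
          refine hedge.trans ?_
          gcongr
          refine hcard.trans ?_
          gcongr
          linarith
      -- The powers `(q^j)^d` cancel; `q^d = 2` and `N + 1 ≤ 3 q^j` make the factor 6.
      _ = (6 * K ^ 2 * (6 * √(d : ℝ)) ^ d * R ^ d) * n * q ^ j := by
          rw [pow_succ q j, mul_pow (q ^ j) q, hqd, ← mul_div_assoc, ← mul_assoc, div_pow]
          field_simp
          ring
      _ ≤ (6 * K ^ 2 * (6 * √(d : ℝ)) ^ d * R ^ d + 2 ^ d * K * R ^ d) * n * q ^ (j + 1) := by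
          gcongr
          · have : 0 ≤ 2 ^ d * K * R ^ d := by positivity
            linarith
          · exact hq.le
          · omega

lemma totalEdgeEvaluations_le (hd : 1 ≤ d) (hs : ∀ j, s j ∈ unitCube d) (hK : SpreadOut K s)
    (hr : ((n : ℝ) ^ (1 / (d : ℝ)))⁻¹ ≤ r₀) (hD : 2 * dispersion s ≤ r₀)
    (hR : r₀ ≤ R * ((n : ℝ) ^ (1 / (d : ℝ)))⁻¹) :
    (totalEdgeEvaluations s a b r₀ : ℝ) ≤
      (6 * K ^ 2 * (6 * √(d : ℝ)) ^ d * R ^ d + 2 ^ d * K * R ^ d) *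
        (((2 : ℝ) ^ (1 / (d : ℝ))) ^ 2 * √(d : ℝ) / ((2 : ℝ) ^ (1 / (d : ℝ)) - 1)) *
        (n : ℝ) ^ (1 + 1 / (d : ℝ)) := by
  have hn : 1 ≤ n := a.pos
  have hn1 : (1 : ℝ) ≤ n := by exact_mod_cast hn
  have hK0 : 0 ≤ K := hK.nonneg hs hn
  have hq := one_lt_two_rpow hd
  have hT : 1 ≤ (n : ℝ) ^ (1 / (d : ℝ)) := Real.one_le_rpow hn1 (by positivity)
  have hR0 : 0 ≤ R := by
    by_contra! h
    have h0 : 0 < ((n : ℝ) ^ (1 / (d : ℝ)))⁻¹ := by positivity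
    exact absurd (h0.trans_le (hr.trans hR)) (not_lt.mpr (mul_nonpos_of_nonpos_of_nonneg h.le h0.le))
  have hm := pow_sInf_le hd hT hr
  have hE := fun i => ncard_edgeSet_batchGraph_le (a := a) (b := b) hd hs hK hr hD hR (i := i)
  rw [Real.rpow_add (by positivity), Real.rpow_one, totalEdgeEvaluations, Nat.cast_sum]
  set T := (n : ℝ) ^ (1 / (d : ℝ))
  set q := (2 : ℝ) ^ (1 / (d : ℝ))
  set A := 6 * K ^ 2 * (6 * √(d : ℝ)) ^ d * R ^ d + 2 ^ d * K * R ^ d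
  have hA : 0 ≤ A := by positivity
  have hq1 : 0 < q - 1 := by linarith
  calc ∑ i ∈ Finset.range (numBatches d r₀), ((batchGraph s a b r₀ i).edgeSet.ncard : ℝ)
      ≤ ∑ i ∈ Finset.range (numBatches d r₀), A * n * q ^ i :=
        Finset.sum_le_sum fun i hi => hE i (Finset.mem_range.mp hi)
    _ = A * n * ((q ^ numBatches d r₀ - 1) / (q - 1)) := by
        rw [← Finset.mul_sum, geom_sum_eq hq.ne']
    _ ≤ A * n * (q * (q * √(d : ℝ) * T) / (q - 1)) := by
        gcongr
        rw [numBatches, pow_succ']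
        have := mul_le_mul_of_nonneg_left hm (by linarith : 0 ≤ q)
        linarith
    _ = A * (q ^ 2 * √(d : ℝ) / (q - 1)) * (n * T) := by ring

end Search

end EdgeBatching

theorem theorem1 (d : ℕ) (hd : 1 ≤ d) (C K R : ℝ) :
    ∃ M : ℝ, ∀ (n : ℕ) (s : Fin n → EuclideanSpace ℝ (Fin d)) (a b : Fin n) (r₀ : ℝ),
      (∀ j, s j ∈ EdgeBatching.unitCube d) →
      EdgeBatching.LowDispersion C s →
      EdgeBatching.SpreadOut K s →
      2 * EdgeBatching.dispersion s < r₀ →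
      r₀ ≤ R * (n : ℝ) ^ (-(1 / (d : ℝ))) →
      (EdgeBatching.numBatches d r₀ : ℝ) ≤ M * (1 + Real.log n) ∧
      (EdgeBatching.totalEdgeEvaluations s a b r₀ : ℝ) ≤ M * (n : ℝ) ^ (1 + 1 / (d : ℝ)) := by
  refine ⟨max
    (1 + d * Real.log ((2 : ℝ) ^ (1 / (d : ℝ)) * √(d : ℝ)) / Real.log 2 + 1 / Real.log 2)
    ((6 * K ^ 2 * (6 * √(d : ℝ)) ^ d * R ^ d + 2 ^ d * K * R ^ d) *
      (((2 : ℝ) ^ (1 / (d : ℝ))) ^ 2 * √(d : ℝ) / ((2 : ℝ) ^ (1 / (d : ℝ)) - 1))), ?_⟩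
  intro n s a b r₀ hs _ hK hD hR
  -- The start is itself a sample, which excludes `n = 0`.
  have hn : 1 ≤ n := a.pos
  have hn1 : (1 : ℝ) ≤ n := by exact_mod_cast hn
  have : Nonempty (Fin n) := ⟨a⟩
  have hr : (n : ℝ) ^ (-(1 / (d : ℝ))) ≤ r₀ :=
    (EdgeBatching.rpow_neg_le_two_mul_of_cover hd hn
      fun x hx => EdgeBatching.exists_dist_le_dispersion hs hx).trans hD.le
  rw [Real.rpow_neg (by positivity)] at hr hR
  have hlog : 0 ≤ Real.log n := Real.log_nonneg hn1
  refine ⟨(EdgeBatching.numBatches_le hd hn hr).trans ?_,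
    (EdgeBatching.totalEdgeEvaluations_le hd hs hK hr hD.le hR).trans ?_⟩
  · gcongr
    exact le_max_left _ _
  · gcongr
    exact le_max_right _ _
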